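/- Let $\mathcal{X}$ be a finite set with a neighborhood relation $\mathcal{N}:\mathcal{X}\to 2^{\mathcal{X}}$ such that $x\notin\mathcal{N}(x)$, $x'\in\mathcal{N}(x)$ if and only if $x\in\mathcal{N}(x')$, and $(\mathcal{X},\mathcal{N})$ is connected as a graph. Let $\pi$ be a probability distribution on $\mathcal{X}$ with $\pi(x)>0$ for every $x$, and let $M=\max_{x\in\mathcal{X}}|\mathcal{N}(x)|$. For constants $\ell<L$ let $h(u)=\ell$ if $u<\ell$, $h(u)=u$ if $\ell\le u\le L$, and $h(u)=L$ if $u>L$. The informed proposal is $$\mathsf{K}_h(x,x')=\frac{h(\pi(x')/\pi(x))}{Z_h(x)}\,\mathbf{1}_{\mathcal{N}(x)}(x'),\qquad Z_h(x)=\sum_{\tilde x\in\mathcal{N}(x)}h\!\left(\frac{\pi(\tilde x)}{\pi(x)}\right),$$ and the informed Metropolis--Hastings transition matrix $\mathsf{P}_h$ is given by $$\mathsf{P}_h(x,x')=\mathsf{K}_h(x,x')\min\left\{1,\frac{\pi(x')\mathsf{K}_h(x',x)}{\pi(x)\mathsf{K}_h(x,x')}\right\}\quad(x'\ne x),\qquad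 \mathsf{P}_h(x,x)=1-\sum_{\tilde x\neq x}\mathsf{P}_h(x,\tilde x),$$ where $\mathsf{P}_h(x,x')=0$ if $x'\ne x$ and $x'\notin\mathcal{N}(x)$. Its lazy version is $\mathsf{P}_h^{\rm lazy}=(\mathsf{P}_h+\mathsf{I})/2$. For a transition matrix $\mathsf{P}$ let $$\tau_x(\mathsf{P},\epsilon)=\min\{t\in\mathbb{N}:\ \|\mathsf{P}^t(x,\cdot)-\pi\|_{\rm TV}\le\epsilon\},\qquad \|\zeta-\pi\|_{\rm TV}=\sup_{A\subset\mathcal{X}}|\zeta(A)-\pi(A)|.$$ For nonempty $\mathcal{X}_0\subset\mathcal{X}$ let $x_0^*$ be a maximizer of $\pi$ on $\mathcal{X}_0$ (any choice if there are several), and let $$R|_{\mathcal{X}_0}=\min_{x\in\mathcal{X}_0\setminus\{x_0^*\}}\ \max_{x'\in\mathcal{N}(x)\cap\mathcal{X}_0}\frac{\pi(x')}{\pi(x)},$$ with the conventions $\min\emptyset=+\infty$ and $\max\emptyset=-\infty$. **Theorem.** Let $\epsilon\in(0,1/2)$, $\eta\in(0,1)$, $\mathcal{X}_0\subset\mathcal{X}$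 and $x_0\in\mathcal{X}_0$ be such that $R|_{\mathcal{X}_0}>M^2$, $\pi(x_0)\ge\eta$ and $\pi(\mathcal{X}_0)\ge 1-\epsilon^2\eta^2/5$. Choose $\ell=M$ and $L\in\mathbb{R}$ with $M^2<L\le R|_{\mathcal{X}_0}$. If $$\max_{x\in\mathcal{X}_0}\ \max_{x'\in\mathcal{N}(x)\setminus\mathcal{X}_0}\frac{\pi(x')}{\pi(x)}<\frac{L}{M}$$ (which is understood to hold if no state of $\mathcal{X}_0$ has a neighbor outside $\mathcal{X}_0$), then $\tau_{x_0}(\mathsf{P}_h^{\rm lazy},\epsilon)$ exists and $$\tau_{x_0}(\mathsf{P}_h^{\rm lazy},\epsilon)\ \le\ 2\,c(\tilde\rho)\,\log\left\{\frac{1}{2\epsilon^2\eta^2}\right\},\qquad \tilde\rho=\frac{L}{M^2},\qquad c(\rho)=\frac{4}{(1-\rho^{-1/2})^{3}},$$ where for $M=0$ (that is, $|\mathcal{X}|=1$) $c(\tilde\rho)$ is read as $4$. -/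

import Mathlib

namespace InformedMH

noncomputable section

/-- The bounded weighting function `clip(u, l, L)`. -/
def clip (l L u : ℝ) : ℝ :=
  if u < l then l else if u ≤ L then u else L

/-- The normalising constant `Z_h(x)`, the sum of `h (π y / π x)` over the neighbours `y` of `x`. -/
def informedZ {X : Type*} [Fintype X] (G : SimpleGraph X) [DecidableRel G.Adj]
    (p : X → ℝ) (h : ℝ → ℝ) (x : X) : ℝ :=
  ∑ y ∈ G.neighborFinset x, h (p y / p x)

/-- The informed proposal `K_h`: from `x`, the neighbour `y` of `x` is drawn with probability
proportional to `h (π y / π x)`. -/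
def informedProposal {X : Type*} [Fintype X] (G : SimpleGraph X) [DecidableRel G.Adj]
    (p : X → ℝ) (h : ℝ → ℝ) : Matrix X X ℝ :=
  Matrix.of fun x y => if G.Adj x y then h (p y / p x) / informedZ G p h x else 0

/-- The Metropolis-Hastings transition matrix with proposal matrix `K` and target `p`. -/
def mhMatrix {X : Type*} [Fintype X] [DecidableEq X] (p : X → ℝ) (K : Matrix X X ℝ) :
    Matrix X X ℝ :=
  Matrix.of fun x y =>
    if y = x then
      1 - ∑ z ∈ Finset.univ.erase x, K x z * min 1 (p z * K z x / (p x * K x z))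
    else K x y * min 1 (p y * K y x / (p x * K x y))

/-- The lazy version `(P + I) / 2` of a transition matrix `P`. -/
def lazyMatrix {X : Type*} [DecidableEq X] (P : Matrix X X ℝ) : Matrix X X ℝ :=
  (2⁻¹ : ℝ) • (P + 1)

/-- The transition matrix of the informed MH algorithm on the graph `G` with target `p` and
weighting function `clip(·, l, L)`. -/
def informedMH {X : Type*} [Fintype X] [DecidableEq X] (G : SimpleGraph X) [DecidableRel G.Adj]
    (p : X → ℝ) (l L : ℝ) : Matrix X X ℝ :=
  mhMatrix p (informedProposal G p (clip l L))

/-- The total variation distance, the supremum over all events `A` of `|μ(A) - ν(A)|`. -/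
def tvDist {X : Type*} [Fintype X] (μ ν : X → ℝ) : ℝ :=
  ⨆ A : Finset X, |∑ x ∈ A, μ x - ∑ x ∈ A, ν x|

/-- `t` is the mixing time of the transition matrix `P` started at `x`: the least natural number
`t` such that `P^t(x, ·)` is within total variation distance `ε` of `p`. -/
def IsMixingTime {X : Type*} [Fintype X] [DecidableEq X] (P : Matrix X X ℝ) (p : X → ℝ)
    (x : X) (ε : ℝ) (t : ℕ) : Prop :=
  IsLeast {s : ℕ | tvDist ((P ^ s) x) p ≤ ε} t

/-- The parameter `R` of the restriction of the target `p` to `X₀`, where `m` is a mode of `p` on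
`X₀`: the minimum over `x ∈ X₀ \ {m}` of the maximum of `p y / p x` over the neighbours `y ∈ X₀`
of `x`. A minimum over the empty set is `+∞`, a maximum over the empty set is `-∞`. -/
def restrictedR {X : Type*} [Fintype X] [DecidableEq X] (G : SimpleGraph X) [DecidableRel G.Adj]
    (p : X → ℝ) (X₀ : Finset X) (m : X) : EReal :=
  (X₀.erase m).inf fun x => (G.neighborFinset x ∩ X₀).sup fun y => ((p y / p x : ℝ) : EReal)

/-- The function `c(ρ) = 4 / (1 - ρ^(-1/2))^3`. -/
def cConst (ρ : ℝ) : ℝ :=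
  4 / (1 - ρ ^ (-(1 / 2) : ℝ)) ^ 3

end

end InformedMH

namespace InformedMH

open Finset

/-! Let `Q` be the lazy chain, `f t` the density of `Q ^ t` started at `x₀` with respect to `p`, and
`V t` the variance of `f t` under `p`. By reversibility `f (t + 1) = Q f t`. Laziness makes `V` drop
by at least a quarter of `∑ p x * P x y * (f t x - f t y) ^ 2`.

A global spectral gap is not available, since nothing is known about the chain outside `X₀`, but it
is not needed. Since `0 ≤ f t ≤ η⁻¹`, the complement of `X₀` adds at most the small constant `δ = ε
^ 2 / 5` to the variance. A Poincaré inequality on `X₀` alone therefore makes `V t - δ` decay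
geometrically (`lazy_sq_norm_le`).

That inequality is `informedMH_restricted_poincare`. From each state of `X₀` except `m`, moves that
multiply `p` by at least `L / M` are proposed with probability at least `1 / 2` and always accepted.
Conditioning on them gives a flow inside `X₀`. A state has at most `M` predecessors, each of mass at
most `M / L` times its own, so the flow carries into it at most `q ^ 2 = M ^ 2 / L` times its mass.
This contraction yields the constant `(1 - q) ^ 2` in `poincare_of_flow`, without any choice of
paths. -/

/-- Poincaré inequality for a function vanishing at `m`, from a flow `T` towards `m` along which
the mass `p` grows geometrically. -/
lemma poincare_of_flow {X : Type*} [DecidableEq X] {p : X → ℝ} (hp : ∀ x, 0 < p x)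
    {X₀ : Finset X} {m : X} (hm : m ∈ X₀) {q : ℝ} (hq0 : 0 < q) (hq1 : q < 1) {T : X → X → ℝ}
    (hT0 : ∀ x ∈ X₀.erase m, ∀ y ∈ X₀, 0 ≤ T x y)
    (hT1 : ∀ x ∈ X₀.erase m, ∑ y ∈ X₀, T x y = 1)
    (hTq : ∀ y ∈ X₀, ∑ x ∈ X₀.erase m, p x * T x y ≤ q ^ 2 * p y)
    (h : X → ℝ) (hh : h m = 0) :
    (1 - q) ^ 2 * ∑ x ∈ X₀, p x * h x ^ 2 ≤
      ∑ x ∈ X₀.erase m, ∑ y ∈ X₀, p x * T x y * (h x - h y) ^ 2 := by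
  have h1q : 0 < 1 - q := by linarith
  set A := ∑ x ∈ X₀, p x * h x ^ 2 with hA
  set D := ∑ x ∈ X₀.erase m, ∑ y ∈ X₀, p x * T x y * (h x - h y) ^ 2 with hD
  have hA' : A = ∑ x ∈ X₀.erase m, p x * h x ^ 2 := by
    rw [hA, ← add_sum_erase _ _ hm, hh]; simp
  -- Young's inequality with weights `1 - q` and `q`: the flow turns the last term into `q⁻¹ * q ^ 2
  -- = q` times `A`, which the left side absorbs.
  have young : ∀ u v : ℝ, u ^ 2 ≤ (1 - q)⁻¹ * (u - v) ^ 2 + q⁻¹ * v ^ 2 := by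
    intro u v
    have : (1 - q)⁻¹ * (u - v) ^ 2 + q⁻¹ * v ^ 2 - u ^ 2 = (q * u - v) ^ 2 / (q * (1 - q)) := by
      field_simp
      ring
    have h2 : 0 ≤ (q * u - v) ^ 2 / (q * (1 - q)) := by positivity
    linarith
  have key : A ≤ (1 - q)⁻¹ * D + q * A := by
    calc A = ∑ x ∈ X₀.erase m, ∑ y ∈ X₀, p x * T x y * h x ^ 2 := by
          rw [hA']
          refine sum_congr rfl fun x hx => ?_
          rw [← sum_mul, ← mul_sum, hT1 x hx, mul_one]
      _ ≤ ∑ x ∈ X₀.erase m, ∑ y ∈ X₀,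
            ((1 - q)⁻¹ * (p x * T x y * (h x - h y) ^ 2) + q⁻¹ * (p x * T x y * h y ^ 2)) := by
          refine sum_le_sum fun x hx => sum_le_sum fun y hy => ?_
          have := mul_le_mul_of_nonneg_left (young (h x) (h y))
            (mul_nonneg (hp x).le (hT0 x hx y hy))
          linarith
      _ = (1 - q)⁻¹ * D + q⁻¹ * ∑ y ∈ X₀, (∑ x ∈ X₀.erase m, p x * T x y) * h y ^ 2 := by
          simp_rw [sum_add_distrib, ← mul_sum]
          rw [sum_comm (s := X₀.erase m) (t := X₀) (f := fun x y => p x * T x y * h y ^ 2)]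
          simp_rw [sum_mul]
          rfl
      _ ≤ (1 - q)⁻¹ * D + q⁻¹ * ∑ y ∈ X₀, q ^ 2 * p y * h y ^ 2 := by
          gcongr with y hy
          exact hTq y hy
      _ = (1 - q)⁻¹ * D + q * A := by
          rw [hA]
          simp_rw [mul_assoc, ← mul_sum]
          field_simp
  have : (1 - q) * A ≤ (1 - q)⁻¹ * D := by linarith
  calc (1 - q) ^ 2 * A = (1 - q) * ((1 - q) * A) := by ring
    _ ≤ (1 - q) * ((1 - q)⁻¹ * D) := by gcongr
    _ = D := by field_simp

/-! ### Reversible chains in `L²` -/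

section Reversible

variable {X : Type*} [Fintype X]

/-- The flow along moves that strictly increase `p` is bounded by the Dirichlet form. -/
lemma uphill_sum_le_dirichlet {p : X → ℝ} {P : Matrix X X ℝ} (hp : ∀ x, 0 < p x)
    (hP0 : ∀ x y, 0 ≤ P x y) (hrev : ∀ x y, p x * P x y = p y * P y x) {s : X → X → Prop}
    [∀ x y, Decidable (s x y)] (hs : ∀ x y, s x y → p x < p y) (g : X → ℝ) :
    ∑ x, ∑ y, (if s x y then p x * P x y * (g x - g y) ^ 2 else 0) ≤
      2⁻¹ * ∑ x, ∑ y, p x * P x y * (g x - g y) ^ 2 := by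
  set B := ∑ x, ∑ y, (if s x y then p x * P x y * (g x - g y) ^ 2 else 0) with hB
  -- Reversibility lets each uphill edge be counted in both directions. The two directions are
  -- disjoint because `p` strictly increases along `s`, whence the factor `1 / 2`.
  have hB' : B = ∑ x, ∑ y, (if s y x then p x * P x y * (g x - g y) ^ 2 else 0) := by
    rw [hB, sum_comm]
    refine sum_congr rfl fun x _ => sum_congr rfl fun y _ => ?_
    rw [hrev y x]
    congr 1
    ring
  have : B + B ≤ ∑ x, ∑ y, p x * P x y * (g x - g y) ^ 2 := by
    nth_rewrite 2 [hB']
    rw [hB, ← sum_add_distrib]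
    refine sum_le_sum fun x _ => ?_
    rw [← sum_add_distrib]
    refine sum_le_sum fun y _ => ?_
    have h0 : 0 ≤ p x * P x y * (g x - g y) ^ 2 :=
      mul_nonneg (mul_nonneg (hp x).le (hP0 x y)) (sq_nonneg _)
    by_cases h1 : s x y
    · have h2 : ¬ s y x := fun h => lt_asymm (hs _ _ h1) (hs _ _ h)
      simp [h1, h2]
    · by_cases h2 : s y x <;> simp [h1, h2, h0]
  linarith

/-- One step of the lazy chain decreases the squared norm by half the Dirichlet form. -/
lemma lazy_sq_norm_decay {p : X → ℝ} {P : Matrix X X ℝ} (hp : ∀ x, 0 < p x)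
    (hP0 : ∀ x y, 0 ≤ P x y) (hP1 : ∀ x, ∑ y, P x y = 1)
    (hrev : ∀ x y, p x * P x y = p y * P y x) (g : X → ℝ) :
    ∑ x, p x * (2⁻¹ * (g x + ∑ y, P x y * g y)) ^ 2 ≤
      ∑ x, p x * g x ^ 2 - 4⁻¹ * ∑ x, ∑ y, p x * P x y * (g x - g y) ^ 2 := by
  set u : X → ℝ := fun x => ∑ y, P x y * g y with hu
  have hin : ∑ x, ∑ y, p x * P x y * g y ^ 2 = ∑ x, p x * g x ^ 2 := by
    rw [sum_comm]
    refine sum_congr rfl fun y _ => ?_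
    simp_rw [hrev _ y]
    rw [← sum_mul, ← mul_sum, hP1, mul_one]
  have hE : ∑ x, ∑ y, p x * P x y * (g x - g y) ^ 2 =
      2 * ∑ x, p x * g x ^ 2 - 2 * ∑ x, p x * g x * u x := by
    have : ∀ x, ∑ y, p x * P x y * (g x - g y) ^ 2 =
        p x * g x ^ 2 + ∑ y, p x * P x y * g y ^ 2 - 2 * (p x * g x * u x) := by
      intro x
      have h1 : p x * g x ^ 2 = ∑ y, p x * P x y * g x ^ 2 := by
        rw [← sum_mul, ← mul_sum, hP1, mul_one]
      rw [h1, hu, mul_sum, mul_sum, ← sum_add_distrib, ← sum_sub_distrib]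
      exact sum_congr rfl fun y _ => by ring
    simp_rw [this]
    rw [sum_sub_distrib, sum_add_distrib, hin, ← mul_sum]
    ring
  -- `P` contracts the `L²` norm, by Jensen's inequality in each row and stationarity of `p`.
  have hJ : ∑ x, p x * u x ^ 2 ≤ ∑ x, p x * g x ^ 2 := by
    rw [← hin]
    refine sum_le_sum fun x _ => ?_
    have h0 : 0 ≤ ∑ y, P x y * (g y - u x) ^ 2 :=
      sum_nonneg fun y _ => mul_nonneg (hP0 x y) (sq_nonneg _)
    have h1 : ∑ y, P x y * (g y - u x) ^ 2 = ∑ y, P x y * g y ^ 2 - u x ^ 2 := by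
      have : ∀ y, P x y * (g y - u x) ^ 2 =
          P x y * g y ^ 2 - 2 * u x * (P x y * g y) + P x y * u x ^ 2 := fun y => by ring
      simp_rw [this]
      rw [sum_add_distrib, sum_sub_distrib, ← mul_sum, ← sum_mul, hP1]
      change _ - 2 * u x * u x + _ = _
      ring
    have h2 : ∑ y, p x * P x y * g y ^ 2 = p x * ∑ y, P x y * g y ^ 2 := by
      rw [mul_sum]; exact sum_congr rfl fun y _ => by ring
    rw [h2]
    exact mul_le_mul_of_nonneg_left (by linarith) (hp x).le
  have hQ : ∑ x, p x * (2⁻¹ * (g x + u x)) ^ 2 =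
      4⁻¹ * (∑ x, p x * g x ^ 2 + 2 * ∑ x, p x * g x * u x + ∑ x, p x * u x ^ 2) := by
    rw [mul_sum, ← sum_add_distrib, ← sum_add_distrib, mul_sum]
    exact sum_congr rfl fun x _ => by ring
  rw [hQ, hE]
  linarith

/-- Total variation is at most half the `L²` distance of the density `f` from `1`. -/
lemma tvDist_le_of_sq_norm_le [DecidableEq X] {p : X → ℝ} (hp : ∀ x, 0 < p x)
    (hp1 : ∑ x, p x = 1) {μ : X → ℝ} (hμ : ∑ x, μ x = 1) {ε : ℝ} (hε : 0 ≤ ε)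
    (hV : ∑ x, p x * (μ x / p x - 1) ^ 2 ≤ 4 * ε ^ 2) : tvDist μ p ≤ ε := by
  refine ciSup_le fun A => ?_
  set g : X → ℝ := fun x => μ x / p x - 1 with hg
  -- Testing `g` against the sign `σ` instead of the indicator of `A` gains the factor `1 / 2`, as
  -- `g` has mean zero. The square completed below is Cauchy-Schwarz.
  set σ : X → ℝ := fun x => if x ∈ A then 1 else -1 with hσ
  have hpg : ∀ x, p x * g x = μ x - p x := fun x => by
    have := (hp x).ne'
    simp only [hg]
    field_simp
  set a := ∑ x ∈ A, μ x - ∑ x ∈ A, p x with ha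
  have hσg : ∑ x, p x * g x * σ x = 2 * a := by
    have h1 : ∀ x, p x * g x * σ x = 2 * (if x ∈ A then μ x - p x else 0) - (μ x - p x) := by
      intro x
      rw [hpg]
      by_cases hx : x ∈ A <;> simp [hσ, hx]
      ring
    simp_rw [h1]
    rw [sum_sub_distrib, ← mul_sum, sum_sub_distrib, hμ, hp1]
    simp [sum_ite_mem, ha]
  have h0 : 0 ≤ ∑ x, p x * (g x - 2 * a * σ x) ^ 2 :=
    sum_nonneg fun x _ => mul_nonneg (hp x).le (sq_nonneg _)
  have h1 : ∑ x, p x * (g x - 2 * a * σ x) ^ 2 =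
      ∑ x, p x * g x ^ 2 - 4 * a * ∑ x, p x * g x * σ x + 4 * a ^ 2 * ∑ x, p x := by
    rw [mul_sum, mul_sum, ← sum_sub_distrib, ← sum_add_distrib]
    refine sum_congr rfl fun x _ => ?_
    have : σ x ^ 2 = 1 := by by_cases hx : x ∈ A <;> simp [hσ, hx]
    linear_combination 4 * a ^ 2 * p x * this
  rw [h1, hσg, hp1] at h0
  exact abs_le_of_sq_le_sq (by nlinarith) hε

/-- The mean minimises the quadratic deviation. It serves with `c = 0` to bound the initial variance
and with `c = f t m` to recentre at the mode. -/
lemma sq_norm_sub_mean_le {p : X → ℝ} (hp1 : ∑ x, p x = 1)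
    {f : X → ℝ} (hf : ∑ x, p x * f x = 1) (c : ℝ) :
    ∑ x, p x * (f x - 1) ^ 2 ≤ ∑ x, p x * (f x - c) ^ 2 := by
  have : ∑ x, p x * (f x - c) ^ 2 - ∑ x, p x * (f x - 1) ^ 2 = (c - 1) ^ 2 := by
    have h1 : ∀ x, p x * (f x - c) ^ 2 - p x * (f x - 1) ^ 2 =
        2 * (1 - c) * (p x * f x) + (c ^ 2 - 1) * p x := fun x => by ring
    rw [← sum_sub_distrib]
    simp_rw [h1]
    rw [sum_add_distrib, ← mul_sum, ← mul_sum, hf, hp1]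
    ring
  nlinarith [sq_nonneg (c - 1)]

end Reversible

/-! ### Lazy chains -/

lemma lazyMatrix_apply {X : Type*} [DecidableEq X] (P : Matrix X X ℝ) (x y : X) :
    lazyMatrix P x y = 2⁻¹ * (P x y + (1 : Matrix X X ℝ) x y) := by
  simp [lazyMatrix]

lemma lazyMatrix_nonneg {X : Type*} [DecidableEq X] {P : Matrix X X ℝ}
    (hP0 : ∀ x y, 0 ≤ P x y) (x y : X) : 0 ≤ lazyMatrix P x y := by
  rw [lazyMatrix_apply, Matrix.one_apply]
  have := hP0 x y
  split_ifs <;> linarith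

lemma lazyMatrix_reversible {X : Type*} [DecidableEq X] {p : X → ℝ} {P : Matrix X X ℝ}
    (hrev : ∀ x y, p x * P x y = p y * P y x) (x y : X) :
    p x * lazyMatrix P x y = p y * lazyMatrix P y x := by
  simp_rw [lazyMatrix_apply, Matrix.one_apply]
  by_cases h : x = y
  · subst h; rfl
  · have h' : ¬ y = x := fun e => h e.symm
    simp only [h, h', if_false, add_zero]
    linear_combination 2⁻¹ * hrev x y

section Lazy

variable {X : Type*} [Fintype X] [DecidableEq X]

lemma sum_lazyMatrix_mul (P : Matrix X X ℝ) (g : X → ℝ) (x : X) :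
    ∑ y, lazyMatrix P x y * g y = 2⁻¹ * (g x + ∑ y, P x y * g y) := by
  simp_rw [lazyMatrix_apply, mul_assoc, add_mul]
  rw [← mul_sum, sum_add_distrib]
  simp [Matrix.one_apply, add_comm]

/-- The density of the law at time `t` evolves under the (reversible) transition matrix. -/
lemma density_succ {p : X → ℝ} (hp : ∀ x, 0 < p x) {Q : Matrix X X ℝ}
    (hrev : ∀ x y, p x * Q x y = p y * Q y x) (x₀ : X) (t : ℕ) (y : X) :
    (Q ^ (t + 1)) x₀ y / p y = ∑ z, Q y z * ((Q ^ t) x₀ z / p z) := by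
  rw [pow_succ, Matrix.mul_apply, sum_div]
  refine sum_congr rfl fun z _ => ?_
  have h1 := (hp y).ne'
  have h2 := (hp z).ne'
  field_simp
  linear_combination (Q ^ t) x₀ z * hrev z y

/-- Exponential decay, up to an error `δ`, of the squared `L²` distance to stationarity of the
lazy chain, from a Poincaré inequality restricted to a set of large mass. -/
lemma lazy_sq_norm_le {p : X → ℝ} {P : Matrix X X ℝ} (hp : ∀ x, 0 < p x) (hp1 : ∑ x, p x = 1)
    (hP0 : ∀ x y, 0 ≤ P x y) (hP1 : ∀ x, ∑ y, P x y = 1)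
    (hrev : ∀ x y, p x * P x y = p y * P y x) {X₀ : Finset X} {m x₀ : X} {η lam δ : ℝ}
    (hη : 0 < η) (hpx₀ : η ≤ p x₀) (hδ0 : 0 ≤ δ) (hδ : ∑ x ∈ X₀ᶜ, p x ≤ δ * η ^ 2)
    (hlam0 : 0 ≤ lam) (hlam1 : lam ≤ 1)
    (hgap : ∀ g : X → ℝ, lam * ∑ x ∈ X₀, p x * (g x - g m) ^ 2 ≤
      4⁻¹ * ∑ x, ∑ y, p x * P x y * (g x - g y) ^ 2) (t : ℕ) :
    ∑ y, p y * ((lazyMatrix P ^ t) x₀ y / p y - 1) ^ 2 ≤ δ + (1 - lam) ^ t * η⁻¹ ∧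
      ∑ y, (lazyMatrix P ^ t) x₀ y = 1 := by
  set Q := lazyMatrix P with hQ
  have hQ0 : ∀ x y, 0 ≤ Q x y := lazyMatrix_nonneg hP0
  have hQ1 : ∀ x, ∑ y, Q x y = 1 := fun x => by
    have := sum_lazyMatrix_mul P (fun _ => 1) x
    simp only [mul_one, hP1] at this
    rw [hQ, this]; norm_num
  have hQr : ∀ x y, p x * Q x y = p y * Q y x := lazyMatrix_reversible hrev
  set f : ℕ → X → ℝ := fun t y => (Q ^ t) x₀ y / p y with hf
  have hfs : ∀ t y, f (t + 1) y = ∑ z, Q y z * f t z := fun t y => density_succ hp hQr x₀ t y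
  have hf0 : ∀ y, f 0 y = if x₀ = y then (p x₀)⁻¹ else 0 := by
    intro y
    simp only [hf, pow_zero, Matrix.one_apply]
    split_ifs with h
    · rw [h, one_div]
    · simp
  have hinv : (p x₀)⁻¹ ≤ η⁻¹ := inv_anti₀ hη hpx₀
  have hη' : 0 < η⁻¹ := inv_pos.mpr hη
  -- Maximum principle: `Q` averages, so the density never exceeds its initial maximum `(p x₀)⁻¹`.
  have hbound : ∀ t y, 0 ≤ f t y ∧ f t y ≤ η⁻¹ := by
    intro t
    induction t with
    | zero =>
      intro y
      rw [hf0]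
      have := inv_pos.mpr (hp x₀)
      split_ifs
      · exact ⟨this.le, hinv⟩
      · exact ⟨le_rfl, hη'.le⟩
    | succ t ih =>
      intro y
      rw [hfs]
      refine ⟨sum_nonneg fun z _ => mul_nonneg (hQ0 y z) (ih z).1, ?_⟩
      calc ∑ z, Q y z * f t z ≤ ∑ z, Q y z * η⁻¹ :=
            sum_le_sum fun z _ => mul_le_mul_of_nonneg_left (ih z).2 (hQ0 y z)
        _ = η⁻¹ := by rw [← sum_mul, hQ1, one_mul]
  have hrow : ∀ t, ∑ y, (Q ^ t) x₀ y = 1 := by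
    intro t
    induction t with
    | zero => simp [Matrix.one_apply]
    | succ t ih =>
      simp_rw [pow_succ, Matrix.mul_apply]
      rw [sum_comm]
      simp_rw [← mul_sum, hQ1, mul_one]
      exact ih
  have hmean : ∀ t, ∑ y, p y * f t y = 1 := fun t => by
    rw [← hrow t]
    refine sum_congr rfl fun y _ => ?_
    have := (hp y).ne'
    simp only [hf]
    field_simp
  refine ⟨?_, hrow t⟩
  set V : ℕ → ℝ := fun t => ∑ y, p y * (f t y - 1) ^ 2 with hV
  have hV0 : V 0 ≤ η⁻¹ := by
    have h1 := sq_norm_sub_mean_le hp1 (hmean 0) 0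
    have h2 : ∑ x, p x * (f 0 x - 0) ^ 2 = (p x₀)⁻¹ := by
      simp_rw [sub_zero, hf0]
      rw [sum_eq_single x₀]
      · have := (hp x₀).ne'
        simp only [if_true]
        field_simp
      · intro y _ hy
        simp [hy.symm]
      · simp
    exact (h1.trans h2.le).trans hinv
  have hVle : ∀ t, V t ≤ ∑ x ∈ X₀, p x * (f t x - f t m) ^ 2 + δ := by
    intro t
    refine (sq_norm_sub_mean_le hp1 (hmean t) (f t m)).trans ?_
    rw [← sum_add_sum_compl X₀]
    gcongr
    calc ∑ x ∈ X₀ᶜ, p x * (f t x - f t m) ^ 2 ≤ ∑ x ∈ X₀ᶜ, p x * η⁻¹ ^ 2 := by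
          refine sum_le_sum fun x _ => mul_le_mul_of_nonneg_left ?_ (hp x).le
          refine sq_le_sq' ?_ ?_ <;> linarith [(hbound t x).1, (hbound t x).2, (hbound t m).1,
            (hbound t m).2]
      _ ≤ δ * η ^ 2 * η⁻¹ ^ 2 := by rw [← sum_mul]; gcongr
      _ = δ := by field_simp
  have hstep : ∀ t, V (t + 1) - δ ≤ (1 - lam) * (V t - δ) := by
    intro t
    have h1 := lazy_sq_norm_decay hp hP0 hP1 hrev (fun x => f t x - 1)
    have h2 : ∀ x, f (t + 1) x - 1 = 2⁻¹ * (f t x - 1 + ∑ y, P x y * (f t y - 1)) := by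
      intro x
      rw [← sum_lazyMatrix_mul P (fun x => f t x - 1) x, hfs]
      simp_rw [mul_sub, mul_one]
      rw [sum_sub_distrib, hQ1]
    have h3 := hgap (fun x => f t x - 1)
    have h4 : V (t + 1) ≤ V t - 4⁻¹ * ∑ x, ∑ y, p x * P x y * (f t x - 1 - (f t y - 1)) ^ 2 := by
      simp only [hV, h2]
      exact h1
    simp only [sub_sub_sub_cancel_right] at h3 h4
    have h5 := mul_le_mul_of_nonneg_left (hVle t) hlam0
    linarith
  have hfin : ∀ t, V t - δ ≤ (1 - lam) ^ t * η⁻¹ := by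
    intro t
    induction t with
    | zero => simpa using by linarith
    | succ t ih =>
      calc _ ≤ (1 - lam) * (V t - δ) := hstep t
        _ ≤ (1 - lam) * ((1 - lam) ^ t * η⁻¹) :=
            mul_le_mul_of_nonneg_left ih (by linarith)
        _ = _ := by ring
  linarith [hfin t]

end Lazy

/-! ### Metropolis-Hastings matrices -/

section MetropolisHastings

variable {X : Type*} [Fintype X] [DecidableEq X]

lemma mhMatrix_of_ne (p : X → ℝ) (K : Matrix X X ℝ) {x y : X} (h : y ≠ x) :
    mhMatrix p K x y = K x y * min 1 (p y * K y x / (p x * K x y)) := by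
  simp [mhMatrix, h]

lemma mul_mhMatrix_of_ne {p : X → ℝ} {K : Matrix X X ℝ} (hp : ∀ x, 0 < p x)
    (hK : ∀ x y, 0 ≤ K x y) {x y : X} (h : y ≠ x) :
    p x * mhMatrix p K x y = min (p x * K x y) (p y * K y x) := by
  rw [mhMatrix_of_ne p K h]
  -- If `K x y = 0`, the acceptance ratio is a division by zero, but its factor `K x y` removes it.
  rcases (hK x y).eq_or_lt with h0 | h0
  · rw [← h0]
    simp [mul_nonneg (hp y).le (hK y x)]
  · have h1 : 0 < p x * K x y := mul_pos (hp x) h0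
    rw [← mul_assoc, mul_min_of_nonneg _ _ h1.le, mul_one, mul_div_cancel₀ _ h1.ne']

lemma mhMatrix_reversible {p : X → ℝ} {K : Matrix X X ℝ} (hp : ∀ x, 0 < p x)
    (hK : ∀ x y, 0 ≤ K x y) (x y : X) :
    p x * mhMatrix p K x y = p y * mhMatrix p K y x := by
  by_cases h : y = x
  · rw [h]
  · rw [mul_mhMatrix_of_ne hp hK h, mul_mhMatrix_of_ne hp hK (Ne.symm h), min_comm]

lemma mhMatrix_le_of_ne {p : X → ℝ} {K : Matrix X X ℝ}
    (hK : ∀ x y, 0 ≤ K x y) {x y : X} (h : y ≠ x) : mhMatrix p K x y ≤ K x y := by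
  rw [mhMatrix_of_ne p K h]
  exact mul_le_of_le_one_right (hK x y) (min_le_left _ _)

lemma mhMatrix_self (p : X → ℝ) (K : Matrix X X ℝ) (x : X) :
    mhMatrix p K x x = 1 - ∑ z ∈ univ.erase x, mhMatrix p K x z := by
  have h : ∑ z ∈ univ.erase x, mhMatrix p K x z =
      ∑ z ∈ univ.erase x, K x z * min 1 (p z * K z x / (p x * K x z)) :=
    sum_congr rfl fun z hz => mhMatrix_of_ne p K (ne_of_mem_erase hz)
  rw [h]
  simp [mhMatrix]

lemma sum_mhMatrix (p : X → ℝ) (K : Matrix X X ℝ) (x : X) : ∑ y, mhMatrix p K x y = 1 := by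
  rw [← add_sum_erase _ _ (mem_univ x), mhMatrix_self]
  ring

lemma mhMatrix_nonneg {p : X → ℝ} {K : Matrix X X ℝ} (hp : ∀ x, 0 < p x)
    (hK : ∀ x y, 0 ≤ K x y) (hK1 : ∀ x, ∑ y, K x y ≤ 1) (x y : X) : 0 ≤ mhMatrix p K x y := by
  by_cases h : y = x
  · subst h
    rw [mhMatrix_self, sub_nonneg]
    calc ∑ z ∈ univ.erase y, mhMatrix p K y z ≤ ∑ z ∈ univ.erase y, K y z :=
          sum_le_sum fun z hz => mhMatrix_le_of_ne hK (ne_of_mem_erase hz)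
      _ ≤ ∑ z, K y z := sum_le_sum_of_subset_of_nonneg (erase_subset _ _) fun z _ _ => hK y z
      _ ≤ 1 := hK1 y
  · rw [mhMatrix_of_ne p K h]
    refine mul_nonneg (hK x y) (le_min zero_le_one (div_nonneg ?_ ?_))
    · exact mul_nonneg (hp y).le (hK y x)
    · exact mul_nonneg (hp x).le (hK x y)

end MetropolisHastings

/-! ### Clipped weights and informed proposals -/

section Clip

variable {l L u : ℝ}

lemma le_clip (h : l ≤ L) : l ≤ clip l L u := by
  unfold clip; split_ifs <;> linarith

lemma clip_le (h : l ≤ L) : clip l L u ≤ L := by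
  unfold clip; split_ifs <;> linarith

lemma clip_le_self (h : l ≤ u) : clip l L u ≤ u := by
  unfold clip; split_ifs <;> linarith

lemma clip_of_le (h : l ≤ L) (hu : u ≤ l) : clip l L u = l := by
  unfold clip; split_ifs <;> linarith

lemma clip_of_ge (h : l ≤ L) (hu : L ≤ u) : clip l L u = L := by
  unfold clip; split_ifs <;> linarith

lemma clip_le_of_le {b : ℝ} (hl : l ≤ b) (hu : u ≤ b) : clip l L u ≤ b := by
  unfold clip; split_ifs <;> linarith

end Clip

section Informed

variable {X : Type*} [Fintype X] {G : SimpleGraph X} [DecidableRel G.Adj] {p : X → ℝ} {h : ℝ → ℝ}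

lemma informedZ_nonneg (hh : ∀ u, 0 ≤ h u) (x : X) : 0 ≤ informedZ G p h x :=
  sum_nonneg fun _ _ => hh _

lemma informedZ_le {L : ℝ} (hL0 : 0 ≤ L) (hL : ∀ u, h u ≤ L) (x : X) :
    informedZ G p h x ≤ G.maxDegree * L := by
  calc informedZ G p h x ≤ ∑ _y ∈ G.neighborFinset x, L := sum_le_sum fun _ _ => hL _
    _ = G.degree x * L := by simp
    _ ≤ G.maxDegree * L := by gcongr; exact G.degree_le_maxDegree x

lemma informedProposal_nonneg (hh : ∀ u, 0 ≤ h u) (x y : X) : 0 ≤ informedProposal G p h x y := by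
  simp only [informedProposal, Matrix.of_apply]
  split_ifs
  · exact div_nonneg (hh _) (informedZ_nonneg hh x)
  · exact le_rfl

/-- Only an inequality: if `Z` vanishes, as at an isolated vertex, the row is zero. -/
lemma sum_informedProposal_le_one (x : X) : ∑ y, informedProposal G p h x y ≤ 1 := by
  simp only [informedProposal, Matrix.of_apply]
  rw [← sum_filter]
  have : univ.filter (G.Adj x) = G.neighborFinset x := by ext; simp
  rw [this, ← sum_div]
  exact div_self_le_one _

end Informed

/-- Below the parameter `R`, every state of `X₀` but the mode has a neighbour in `X₀` whose mass is
larger by the factor `L`. -/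
lemma exists_adj_of_le_restrictedR {X : Type*} [Fintype X] [DecidableEq X] {G : SimpleGraph X}
    [DecidableRel G.Adj] {p : X → ℝ} {X₀ : Finset X} {m : X} {L : ℝ}
    (hLR : (L : EReal) ≤ restrictedR G p X₀ m) {x : X} (hx : x ∈ X₀.erase m) :
    ∃ y ∈ X₀, G.Adj x y ∧ L ≤ p y / p x := by
  by_contra! hcon
  have h1 := (Finset.le_inf_iff.mp hLR) x hx
  -- The side condition `⊥ < L` covers states without neighbours in `X₀`, where the supremum is `⊥`.
  refine absurd h1 (not_le.mpr ((Finset.sup_lt_iff (EReal.bot_lt_coe L)).mpr fun y hy => ?_))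
  rw [mem_inter, SimpleGraph.mem_neighborFinset] at hy
  exact EReal.coe_lt_coe_iff.mpr (hcon y hy.2 hy.1)

/-! ### Accepted uphill moves and the restricted Poincaré inequality -/

section InformedMH

variable {X : Type*} [Fintype X] [DecidableEq X] {G : SimpleGraph X} [DecidableRel G.Adj]
  {p : X → ℝ} {M L : ℝ}

/-- From a state with a neighbour better by the factor `L`, proposals to neighbours better by the
factor `L / M` are always accepted. -/
lemma informedMH_eq_informedProposal (hp : ∀ x, 0 < p x) (hM : M = G.maxDegree) (hM1 : 1 ≤ M)
    (hML : M ^ 2 < L) {x y w : X} (hxw : G.Adj x w) (hw : L ≤ p w / p x) (hxy : G.Adj x y)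
    (hy : L / M ≤ p y / p x) :
    informedMH G p M L x y = informedProposal G p (clip M L) x y := by
  have hM0 : 0 < M := by linarith
  have hMleL : M ≤ L := by nlinarith
  have hL0 : 0 < L := by linarith
  have hMLM : M ≤ L / M := by rw [le_div_iff₀ hM0]; nlinarith
  have hc0 : ∀ u, 0 ≤ clip M L u := fun u => hM0.le.trans (le_clip hMleL)
  have hZx : L ≤ informedZ G p (clip M L) x :=
    (clip_of_ge hMleL hw).ge.trans <|
      single_le_sum (f := fun y => clip M L (p y / p x)) (fun _ _ => hc0 _)
        ((G.mem_neighborFinset x w).mpr hxw)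
  have hZy : informedZ G p (clip M L) y ≤ M * L := by
    rw [hM]
    exact informedZ_le hL0.le (fun u => clip_le (hM ▸ hMleL)) y
  have hZy0 : 0 < informedZ G p (clip M L) y := by
    refine hM0.trans_le ((le_clip (u := p x / p y) hMleL).trans ?_)
    exact single_le_sum (f := fun z => clip M L (p z / p y)) (fun _ _ => hc0 _)
      ((G.mem_neighborFinset y x).mpr hxy.symm)
  have hback : clip M L (p x / p y) = M := by
    refine clip_of_le hMleL ?_
    have h1 : 1 ≤ p y / p x := hM1.trans (hMLM.trans hy)
    rw [← inv_div]
    exact (inv_le_one_of_one_le₀ h1).trans hM1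
  have hfwd : clip M L (p y / p x) ≤ p y / p x := clip_le_self (hMLM.trans hy)
  have hne : y ≠ x := hxy.ne'
  have hx0 := (hp x).ne'
  have hx := hp x
  -- Both sides are compared with `p y / L`: forward, the weight is at most `p y / p x` and `Z x ≥
  -- L`; backward, the weight is exactly `M` and `Z y ≤ M * L`.
  have hlow : p x * informedProposal G p (clip M L) x y ≤
      p y * informedProposal G p (clip M L) y x := by
    simp only [informedProposal, Matrix.of_apply, hxy, hxy.symm, if_true, hback]
    calc p x * (clip M L (p y / p x) / informedZ G p (clip M L) x)
        ≤ p x * (p y / p x / L) := by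
          have := hp y
          gcongr
      _ = p y * (M / (M * L)) := by field_simp
      _ ≤ p y * (M / informedZ G p (clip M L) y) := by
          have := hp y
          gcongr
  have := mul_mhMatrix_of_ne hp (informedProposal_nonneg (G := G) (p := p) hc0) hne
  rw [min_eq_left hlow] at this
  exact mul_left_cancel₀ hx0 this

/-- From every state of `X₀` but the mode, the proposal moves with probability at least `1 / 2` to
a state of `X₀` better by the factor `L / M`. -/
lemma half_le_sum_informedProposal (hM : M = G.maxDegree) (hM1 : 1 ≤ M)
    (hML : M ^ 2 < L) {X₀ : Finset X} {x w : X} (hxw : G.Adj x w)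
    (hw : L ≤ p w / p x) (hbd : ∀ y ∈ G.neighborFinset x \ X₀, p y / p x < L / M) :
    2⁻¹ ≤ ∑ y ∈ X₀, if G.Adj x y ∧ L / M ≤ p y / p x then
      informedProposal G p (clip M L) x y else 0 := by
  have hM0 : 0 < M := by linarith
  have hMleL : M ≤ L := by nlinarith
  have hL0 : 0 < L := by linarith
  have hMLM : M ≤ L / M := by rw [le_div_iff₀ hM0]; nlinarith
  have hLML : L / M ≤ L := div_le_self hL0.le hM1
  have hc0 : ∀ u, 0 ≤ clip M L u := fun u => hM0.le.trans (le_clip hMleL)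
  set h := clip M L with hh
  set N := G.neighborFinset x with hN
  set S := N.filter fun y => L / M ≤ p y / p x with hS
  have hsum : ∑ y ∈ X₀, (if G.Adj x y ∧ L / M ≤ p y / p x then
      informedProposal G p h x y else 0) = (∑ y ∈ S, h (p y / p x)) / informedZ G p h x := by
    rw [← sum_filter, sum_div]
    -- By `hbd`, neighbours outside `X₀` miss the threshold `L / M`, so every good move stays in
    -- `X₀`.
    have hset : (X₀.filter fun y => G.Adj x y ∧ L / M ≤ p y / p x) = S := by
      ext y
      simp only [hS, hN, mem_filter, SimpleGraph.mem_neighborFinset]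
      refine ⟨fun hy => hy.2, fun hy => ⟨?_, hy⟩⟩
      by_contra hy0
      have := hbd y (mem_sdiff.mpr ⟨(G.mem_neighborFinset x y).mpr hy.1, hy0⟩)
      linarith [hy.2]
    rw [hset]
    refine sum_congr rfl fun y hy => ?_
    have hxy : G.Adj x y := (G.mem_neighborFinset x y).mp (mem_filter.mp hy).1
    simp [informedProposal, hxy]
  rw [hsum]
  -- The neighbour `w` alone contributes `L` to the good moves, while at most `M` bad ones
  -- contribute at most `L / M` each.
  have hLS : L ≤ ∑ y ∈ S, h (p y / p x) := by
    rw [← clip_of_ge hMleL hw]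
    refine single_le_sum (f := fun y => h (p y / p x)) (fun _ _ => hc0 _) (mem_filter.mpr ⟨?_, ?_⟩)
    · exact (G.mem_neighborFinset x w).mpr hxw
    · exact hLML.trans hw
  have hrest : ∑ y ∈ N.filter (fun y => ¬ L / M ≤ p y / p x), h (p y / p x) ≤ L := by
    calc _ ≤ ∑ _y ∈ N.filter (fun y => ¬ L / M ≤ p y / p x), L / M :=
          sum_le_sum fun y hy => clip_le_of_le hMLM (not_le.mp (mem_filter.mp hy).2).le
      _ ≤ M * (L / M) := by
          rw [sum_const, nsmul_eq_mul]
          gcongr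
          rw [hM]
          exact_mod_cast (card_filter_le _ _).trans (G.degree_le_maxDegree x)
      _ = L := by field_simp
  have hZ : informedZ G p h x = ∑ y ∈ S, h (p y / p x) +
      ∑ y ∈ N.filter (fun y => ¬ L / M ≤ p y / p x), h (p y / p x) :=
    (sum_filter_add_sum_filter_not _ _ _).symm
  rw [hZ, le_div_iff₀ (by
    have : 0 ≤ ∑ y ∈ N.filter (fun y => ¬ L / M ≤ p y / p x), h (p y / p x) :=
      sum_nonneg fun _ _ => hc0 _
    linarith)]
  linarith

/-- The Poincaré inequality of the informed Metropolis-Hastings chain restricted to `X₀`. -/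
lemma informedMH_restricted_poincare (hp : ∀ x, 0 < p x) (hM : M = G.maxDegree) (hM1 : 1 ≤ M)
    (hML : M ^ 2 < L) {X₀ : Finset X} {m : X} (hm : m ∈ X₀)
    (hLR : (L : EReal) ≤ restrictedR G p X₀ m)
    (hbd : ∀ x ∈ X₀, ∀ y ∈ G.neighborFinset x \ X₀, p y / p x < L / M)
    {q : ℝ} (hq0 : 0 < q) (hq1 : q < 1) (hq : q ^ 2 = M ^ 2 / L)
    (hP0 : ∀ x y, 0 ≤ informedMH G p M L x y)
    (hrev : ∀ x y, p x * informedMH G p M L x y = p y * informedMH G p M L y x) (g : X → ℝ) :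
    (1 - q) ^ 2 * ∑ x ∈ X₀, p x * (g x - g m) ^ 2 ≤
      ∑ x, ∑ y, p x * informedMH G p M L x y * (g x - g y) ^ 2 := by
  classical
  have hM0 : 0 < M := by linarith
  have hL0 : 0 < L := by nlinarith
  have hLM1 : 1 < L / M := by rw [lt_div_iff₀ hM0]; nlinarith
  set P := informedMH G p M L with hP
  let s : X → X → Prop := fun x y => G.Adj x y ∧ L / M ≤ p y / p x
  let W : X → X → ℝ := fun x y => if s x y then P x y else 0
  have hW0 : ∀ x y, 0 ≤ W x y := fun x y => by
    simp only [W]; split_ifs; exacts [hP0 x y, le_rfl]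
  let w : X → ℝ := fun x => ∑ y ∈ X₀, W x y
  have hw : ∀ x ∈ X₀.erase m, 2⁻¹ ≤ w x := by
    intro x hx
    obtain ⟨b, _, hxb, hb⟩ := exists_adj_of_le_restrictedR hLR hx
    have h1 := half_le_sum_informedProposal hM hM1 hML hxb hb (hbd x (mem_of_mem_erase hx))
    refine h1.trans (sum_le_sum fun y _ => ?_)
    simp only [W, s]
    split_ifs with hy
    · exact (informedMH_eq_informedProposal hp hM hM1 hML hxb hb hy.1 hy.2).ge
    · exact le_rfl
  have hw0 : ∀ x ∈ X₀.erase m, 0 < w x := fun x hx => by linarith [hw x hx]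
  have hgrow : ∀ x y, s x y → p x ≤ M / L * p y := by
    intro x y hs
    have h1 := hs.2
    rw [div_le_div_iff₀ hM0 (hp x)] at h1
    rw [div_mul_eq_mul_div, le_div_iff₀ hL0]
    linarith
  have hs_lt : ∀ x y, s x y → p x < p y := fun x y hs => by
    have := hLM1.trans_le hs.2
    rwa [one_lt_div (hp x)] at this
  have hTq : ∀ y ∈ X₀, ∑ x ∈ X₀.erase m, p x * (W x y / w x) ≤ q ^ 2 * p y := by
    intro y hy
    calc ∑ x ∈ X₀.erase m, p x * (W x y / w x)
        ≤ ∑ x ∈ X₀.erase m, if G.Adj y x then M / L * p y else 0 := by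
          refine sum_le_sum fun x hx => ?_
          by_cases hs : s x y
          · rw [if_pos hs.1.symm]
            have h1 : W x y / w x ≤ 1 :=
              div_le_one_of_le₀ (single_le_sum (fun z _ => hW0 x z) hy) (hw0 x hx).le
            exact (mul_le_of_le_one_right (hp x).le h1).trans (hgrow x y hs)
          · have : W x y = 0 := if_neg hs
            rw [this]
            have := hp y
            split_ifs <;> simp; positivity
      _ ≤ ∑ x, if G.Adj y x then M / L * p y else 0 := by
          refine sum_le_sum_of_subset_of_nonneg (subset_univ _) fun x _ _ => ?_
          have := hp y
          split_ifs <;> positivity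
      _ = G.degree y * (M / L * p y) := by
          rw [← sum_filter, sum_const, nsmul_eq_mul, ← G.card_neighborFinset_eq_degree]
          congr 3
          ext; simp
      _ ≤ M * (M / L * p y) := by
          have := hp y
          gcongr
          rw [hM]
          exact_mod_cast G.degree_le_maxDegree y
      _ = q ^ 2 * p y := by rw [hq]; ring
  have hpoin := poincare_of_flow hp hm hq0 hq1 (T := fun x y => W x y / w x)
    (fun x hx y _ => div_nonneg (hW0 x y) (hw0 x hx).le)
    (fun x hx => by rw [← sum_div]; exact div_self (hw0 x hx).ne') hTq
    (fun x => g x - g m) (sub_self _)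
  simp only [sub_sub_sub_cancel_right] at hpoin
  have hF0 : ∀ x y, 0 ≤ if s x y then p x * P x y * (g x - g y) ^ 2 else 0 := by
    intro x y
    split_ifs
    · exact mul_nonneg (mul_nonneg (hp x).le (hP0 x y)) (sq_nonneg _)
    · exact le_rfl
  have hdir := uphill_sum_le_dirichlet hp hP0 hrev hs_lt g
  -- The factor `2` lost in normalising by `w x ≥ 1 / 2` is recovered from the `1 / 2` in `hdir`.
  calc _ ≤ _ := hpoin
    _ ≤ ∑ x ∈ X₀.erase m, ∑ y ∈ X₀,
          2 * (if s x y then p x * P x y * (g x - g y) ^ 2 else 0) := by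
        refine sum_le_sum fun x hx => sum_le_sum fun y _ => ?_
        have h1 : W x y / w x ≤ 2 * W x y := by
          rw [div_le_iff₀ (hw0 x hx)]
          nlinarith [hW0 x y, hw x hx]
        calc p x * (W x y / w x) * (g x - g y) ^ 2
            ≤ p x * (2 * W x y) * (g x - g y) ^ 2 := by
              have := hp x
              gcongr
          _ = _ := by
              simp only [W]
              split_ifs <;> ring
    _ ≤ ∑ x, ∑ y, 2 * (if s x y then p x * P x y * (g x - g y) ^ 2 else 0) := by
        have h2 : ∀ x y, 0 ≤ 2 * (if s x y then p x * P x y * (g x - g y) ^ 2 else 0) :=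
          fun x y => mul_nonneg zero_le_two (hF0 x y)
        refine (sum_le_sum fun x _ => sum_le_sum_of_subset_of_nonneg (subset_univ X₀)
          fun y _ _ => h2 x y).trans ?_
        exact sum_le_sum_of_subset_of_nonneg (subset_univ _) fun x _ _ =>
          sum_nonneg fun y _ => h2 x y
    _ ≤ _ := by
        simp_rw [← mul_sum]
        linarith

end InformedMH

/-! ### From `L²` decay to the mixing time -/

lemma exists_isMixingTime_le {X : Type*} [Fintype X] [DecidableEq X] {P : Matrix X X ℝ}
    {p : X → ℝ} {x : X} {ε : ℝ} {t : ℕ} (h : tvDist ((P ^ t) x) p ≤ ε) :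
    ∃ τ ≤ t, IsMixingTime P p x ε τ := by
  classical
  have hex : ∃ s, tvDist ((P ^ s) x) p ≤ ε := ⟨t, h⟩
  exact ⟨Nat.find hex, Nat.find_min' hex h, Nat.find_spec hex, fun s hs => Nat.find_min' hex hs⟩

/-- After `⌊T⌋` steps at rate `lam`, where `T ≥ 2 lam⁻¹ log (1 / (2 ε² η²))`, the squared `L²`
distance is small enough. -/
lemma decay_at_floor {ε η lam T : ℝ} (hε : ε ∈ Set.Ioo (0 : ℝ) (1 / 2))
    (hη : η ∈ Set.Ioo (0 : ℝ) 1) (hlam0 : 0 < lam) (hlam1 : lam ≤ 1 / 4)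
    (hT : 2 * Real.log (1 / (2 * ε ^ 2 * η ^ 2)) ≤ lam * T) :
    (1 - lam) ^ ⌊T⌋₊ * η⁻¹ ≤ 3 * ε ^ 2 := by
  obtain ⟨hε0, hε1⟩ := hε
  obtain ⟨hη0, hη1⟩ := hη
  have hfl : T - 1 < ⌊T⌋₊ := Nat.sub_one_lt_floor T
  have hz : 0 < 2 * ε ^ 2 * η ^ 2 := by positivity
  have h1 : (1 - lam) ^ ⌊T⌋₊ ≤ Real.exp (-lam) ^ ⌊T⌋₊ :=
    pow_le_pow_left₀ (by linarith) (Real.one_sub_le_exp_neg lam) _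
  have h2 : Real.exp (-lam) ^ ⌊T⌋₊ ≤ 3 * (2 * ε ^ 2 * η ^ 2) ^ 2 := by
    calc Real.exp (-lam) ^ ⌊T⌋₊ = Real.exp (⌊T⌋₊ * -lam) := (Real.exp_nat_mul _ _).symm
      -- Rounding `T` down loses less than one step, hence at most `lam ≤ 1` in the exponent. The
      -- resulting factor `exp 1` is below `3`.
      _ ≤ Real.exp (1 + 2 * Real.log (2 * ε ^ 2 * η ^ 2)) := by
          rw [Real.exp_le_exp]
          rw [one_div, Real.log_inv] at hT
          nlinarith
      _ = Real.exp 1 * (2 * ε ^ 2 * η ^ 2) ^ 2 := by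
          rw [Real.exp_add, two_mul (Real.log _), Real.exp_add, Real.exp_log hz,
            sq (2 * ε ^ 2 * η ^ 2)]
      _ ≤ _ := by
          gcongr
          linarith [Real.exp_one_lt_d9]
  calc (1 - lam) ^ ⌊T⌋₊ * η⁻¹ ≤ 3 * (2 * ε ^ 2 * η ^ 2) ^ 2 * η⁻¹ := by
        gcongr
        exact h1.trans h2
    _ = 3 * ε ^ 2 * ((4 * ε ^ 2) * η ^ 3) := by field_simp; ring
    _ ≤ 3 * ε ^ 2 * 1 := by
        gcongr
        have : 4 * ε ^ 2 ≤ 1 := by nlinarith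
        exact mul_le_one₀ this (by positivity) (pow_le_one₀ hη0.le hη1.le)
    _ = _ := mul_one _

end InformedMH

theorem theorem5 {X : Type*} [Fintype X] [DecidableEq X]
    (G : SimpleGraph X) [DecidableRel G.Adj] (hG : G.Connected)
    (p : X → ℝ) (hp_pos : ∀ x, 0 < p x) (hp_sum : ∑ x, p x = 1)
    (ε η : ℝ) (hε : ε ∈ Set.Ioo (0 : ℝ) (1 / 2)) (hη : η ∈ Set.Ioo (0 : ℝ) 1)
    (X₀ : Finset X) (x₀ : X) (hx₀ : x₀ ∈ X₀)
    (m : X) (hm : m ∈ X₀) (hmode : ∀ x ∈ X₀, p x ≤ p m)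
    (hR : (((G.maxDegree : ℝ) ^ 2 : ℝ) : EReal) < InformedMH.restrictedR G p X₀ m)
    (hpx₀ : η ≤ p x₀)
    (hpX₀ : 1 - ε ^ 2 * η ^ 2 / 5 ≤ ∑ x ∈ X₀, p x)
    (L : ℝ) (hL : (G.maxDegree : ℝ) ^ 2 < L)
    (hLR : (L : EReal) ≤ InformedMH.restrictedR G p X₀ m)
    (hbd : ∀ x ∈ X₀, ∀ y ∈ G.neighborFinset x \ X₀, p y / p x < L / (G.maxDegree : ℝ)) :
    ∃ τ : ℕ,
      InformedMH.IsMixingTime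
        (InformedMH.lazyMatrix (InformedMH.informedMH G p (G.maxDegree : ℝ) L)) p x₀ ε τ ∧
      (τ : ℝ) ≤ 2 * InformedMH.cConst (L / (G.maxDegree : ℝ) ^ 2) *
        Real.log (1 / (2 * ε ^ 2 * η ^ 2)) := by
  have hlog : 0 ≤ Real.log (1 / (2 * ε ^ 2 * η ^ 2)) := by
    obtain ⟨hε0, hε1⟩ := hε
    obtain ⟨hη0, hη1⟩ := hη
    refine Real.log_nonneg ((one_le_div (by positivity)).mpr ?_)
    have h1 : 2 * ε ^ 2 ≤ 1 := by nlinarith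
    exact mul_le_one₀ h1 (by positivity) (pow_le_one₀ hη0.le hη1.le)
  rcases Nat.eq_zero_or_pos G.maxDegree with hM | hM
  · have hsub : Subsingleton X := by
      by_contra hns
      rw [not_subsingleton_iff_nontrivial] at hns
      have h1 := hG.preconnected.degree_pos_of_nontrivial x₀
      have h2 := G.degree_le_maxDegree x₀
      omega
    have hall : ∀ x, x = x₀ := fun x => Subsingleton.elim _ _
    have htv : InformedMH.tvDist
        ((InformedMH.lazyMatrix (InformedMH.informedMH G p (G.maxDegree : ℝ) L) ^ 0) x₀) p ≤ ε := by
      have hpx : p x₀ = 1 := by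
        rw [← hp_sum, Fintype.sum_subsingleton _ x₀]
      refine ciSup_le fun A => ?_
      rw [← Finset.sum_sub_distrib, Finset.sum_eq_zero, abs_zero]
      · exact hε.1.le
      · intro x _
        rw [hall x, hpx]
        simp
    obtain ⟨τ, hτ, hmix⟩ := InformedMH.exists_isMixingTime_le htv
    refine ⟨τ, hmix, ?_⟩
    rw [Nat.le_zero.mp hτ, hM]
    -- Division by zero gives `ρ = 0`, and `0 ^ (-1 / 2) = 0` for real powers, so `cConst` takes the
    -- value `4` required by the convention.
    have hc : InformedMH.cConst (L / ((0 : ℕ) : ℝ) ^ 2) = 4 := by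
      norm_num [InformedMH.cConst]
    rw [hc]
    push_cast
    positivity
  · obtain ⟨M, hMdef⟩ : ∃ M : ℝ, M = G.maxDegree := ⟨_, rfl⟩
    rw [← hMdef] at hL hbd ⊢
    have hM1 : 1 ≤ M := by rw [hMdef]; exact_mod_cast hM
    have hM0 : 0 < M := by linarith
    have hMleL : M ≤ L := by nlinarith
    have hL0 : 0 < L := by linarith
    have hρ : 1 < L / M ^ 2 := (one_lt_div (by positivity)).mpr hL
    set q : ℝ := (L / M ^ 2) ^ (-(1 / 2) : ℝ) with hqdef
    have hq0 : 0 < q := Real.rpow_pos_of_pos (by linarith) _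
    have hq1 : q < 1 := Real.rpow_lt_one_of_one_lt_of_neg hρ (by norm_num)
    have hq2 : q ^ 2 = M ^ 2 / L := by
      rw [hqdef, ← Real.rpow_natCast, ← Real.rpow_mul (by linarith)]
      norm_num [Real.rpow_neg_one]
    have hc0 : ∀ u, 0 ≤ InformedMH.clip M L u := fun u => hM0.le.trans (InformedMH.le_clip hMleL)
    have hK0 := InformedMH.informedProposal_nonneg (G := G) (p := p) hc0
    have hP0 : ∀ x y, 0 ≤ InformedMH.informedMH G p M L x y :=
      InformedMH.mhMatrix_nonneg hp_pos hK0 InformedMH.sum_informedProposal_le_one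
    have hP1 : ∀ x, ∑ y, InformedMH.informedMH G p M L x y = 1 := InformedMH.sum_mhMatrix p _
    have hrev : ∀ x y, p x * InformedMH.informedMH G p M L x y =
        p y * InformedMH.informedMH G p M L y x :=
      InformedMH.mhMatrix_reversible hp_pos hK0
    have hgap := InformedMH.informedMH_restricted_poincare hp_pos hMdef hM1 hL hm hLR hbd
      hq0 hq1 hq2 hP0 hrev
    -- The divisor `4` matches the `4⁻¹` in the one-step decay of the lazy chain.
    set lam : ℝ := (1 - q) ^ 2 / 4 with hlam
    have h1q : 0 < 1 - q := by linarith
    have hlam0 : 0 < lam := by positivity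
    have hlam1 : lam ≤ 1 / 4 := by
      rw [hlam]
      have : (1 - q) ^ 2 ≤ 1 := pow_le_one₀ h1q.le (by linarith)
      linarith
    have hmass : ∑ x ∈ X₀ᶜ, p x ≤ ε ^ 2 / 5 * η ^ 2 := by
      have := Finset.sum_add_sum_compl X₀ p
      linarith
    set T : ℝ := 2 * InformedMH.cConst (L / M ^ 2) * Real.log (1 / (2 * ε ^ 2 * η ^ 2)) with hT
    -- The cube in `cConst` exceeds the square in `lam` by one factor `(1 - q)⁻¹ ≥ 1`, which is
    -- discarded.
    have hlamT : 2 * Real.log (1 / (2 * ε ^ 2 * η ^ 2)) ≤ lam * T := by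
      have : lam * T = 2 * Real.log (1 / (2 * ε ^ 2 * η ^ 2)) * (1 - q)⁻¹ := by
        rw [hlam, hT, InformedMH.cConst, ← hqdef]
        field_simp
      rw [this]
      exact le_mul_of_one_le_right (by positivity) ((one_le_inv₀ h1q).mpr (by linarith))
    have hT0 : 0 ≤ T := by
      rw [hT, InformedMH.cConst, ← hqdef]
      positivity
    obtain ⟨hV, hrow⟩ := InformedMH.lazy_sq_norm_le hp_pos hp_sum hP0 hP1 hrev
      (x₀ := x₀) (m := m) (lam := lam) hη.1
      hpx₀ (by positivity) hmass hlam0.le (by linarith) (fun g => by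
        have := hgap g
        rw [hlam]
        linarith) ⌊T⌋₊
    have hdecay := InformedMH.decay_at_floor hε hη hlam0 hlam1 hlamT
    -- The total error is `ε ^ 2 / 5 + 3 * ε ^ 2 ≤ 4 * ε ^ 2`.
    obtain ⟨τ, hτ, hmix⟩ := InformedMH.exists_isMixingTime_le
      (InformedMH.tvDist_le_of_sq_norm_le hp_pos hp_sum hrow hε.1.le (by nlinarith [sq_nonneg ε]))
    exact ⟨τ, hmix, (Nat.cast_le.mpr hτ).trans (Nat.floor_le hT0)⟩
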